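/- **Theorem 1.1.** Let $n,k$ be integers with $1\le k\le n-1$, let $\Omega\subset\mathbb R^n$ be a bounded domain (nonempty, open, connected), and let $\psi:\Omega\times\mathbb R\times\mathbb R^n\to\mathbb R$ be a function. For $\lambda\in\mathbb R^n$ put $S_k(\lambda)=\sum_{1\le i_1<\dots<i_k\le n}\lambda_{i_1}\cdots\lambda_{i_k}$; for a real symmetric $n\times n$ matrix $A$ let $S_k(A)=S_k(\lambda)$, where $\lambda=(\lambda_1,\dots,\lambda_n)$ are the eigenvalues of $A$; and let $\Gamma_k$ be the connected component of $\{\lambda\in\mathbb R^n: S_k(\lambda)>0\}$ that contains the cone $\{\lambda:\lambda_i>0\text{ for all }i\}$. A function $u\in C^2(\Omega)$ is called $k$-convex if for every $x\in\Omega$ the vector of eigenvalues of the Hessian $D^2u(x)$ lies in $\overline{\Gamma_k}$. Suppose that there are real constants $M,\gamma,q\ge 0$ with $\gamma+q\le k$ such that $$0\le\psi(x,z,p)\le M\bigl(1+(z^+)^q\bigr)\bigl(1+|p|^\gamma\bigr)\qquad\text{for all }(x,z,p)\in\Omega\times\mathbb R\times\mathbb R^n,$$ where $z^+=\max\{z,0\}$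 (and $0^0=1$). Then there is no $k$-convex function $u\in C^2(\Omega)$ satisfying $$S_k(D^2u)=\psi(x,u,Du)\quad\text{in }\Omega,\qquad u=+\infty\quad\text{on }\partial\Omega,$$ where the boundary condition means that $u(x)\to+\infty$ as $d(x,\partial\Omega)\to0$, $x\in\Omega$. -/

import Mathlib

open Set Filter Topology

noncomputable section

namespace HessianEq

/-- The `k`-th elementary symmetric function on `ℝⁿ`,
`S_k(l) = ∑_{i₁ < ⋯ < i_k} l_{i₁} ⋯ l_{i_k}`. -/
def symm {n : ℕ} (k : ℕ) (l : Fin n → ℝ) : ℝ :=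
  ∑ s ∈ Finset.powersetCard k (Finset.univ : Finset (Fin n)), ∏ i ∈ s, l i

/-- The positive cone `Γ⁺` in `ℝⁿ`. -/
def posCone (n : ℕ) : Set (Fin n → ℝ) := {l | ∀ i, 0 < l i}

/-- The Gårding cone `Γ_k`: the connected component of `{S_k > 0}` that contains the positive cone,
described as the component of the point `(1, …, 1)` of that cone
(`posCone_subset_gardingCone` shows that it contains the whole positive cone). -/
def gardingCone (n k : ℕ) : Set (Fin n → ℝ) :=
  connectedComponentIn {l : Fin n → ℝ | 0 < symm k l} (fun _ => 1)

/-- The vector of eigenvalues, with multiplicity, of a real symmetric matrix. It is used for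
symmetric matrices only (`hessian_isHermitian`); the value at other matrices is arbitrary. -/
def eigs {n : ℕ} (A : Matrix (Fin n) (Fin n) ℝ) : Fin n → ℝ :=
  open Classical in if h : A.IsHermitian then h.eigenvalues else 0

/-- `S_k(A)`, the `k`-th elementary symmetric function of the eigenvalues of `A`. -/
def symmMat {n : ℕ} (k : ℕ) (A : Matrix (Fin n) (Fin n) ℝ) : ℝ := symm k (eigs A)

/-- The Hessian matrix `D²u(x)`, with entries `∂ᵢ∂ⱼu(x)`. -/
def hessian {n : ℕ} (u : EuclideanSpace ℝ (Fin n) → ℝ) (x : EuclideanSpace ℝ (Fin n)) :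
    Matrix (Fin n) (Fin n) ℝ :=
  Matrix.of fun i j =>
    fderiv ℝ (fderiv ℝ u) x (EuclideanSpace.single i 1) (EuclideanSpace.single j 1)

/-- A `k`-convex function on the open set `Ω`: it is of class `C²` on `Ω`, and at every point of `Ω`
the eigenvalues of its Hessian lie in the closure of `Γ_k`. -/
def IsKConvexOn {n : ℕ} (k : ℕ) (Ω : Set (EuclideanSpace ℝ (Fin n)))
    (u : EuclideanSpace ℝ (Fin n) → ℝ) : Prop :=
  ContDiffOn ℝ 2 u Ω ∧ ∀ x ∈ Ω, eigs (hessian u x) ∈ closure (gardingCone n k)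

/-- `S_k(D²u) = ψ(x, u, Du)` at every point of `Ω`. -/
def SolvesHessianEq {n : ℕ} (k : ℕ) (Ω : Set (EuclideanSpace ℝ (Fin n)))
    (ψ : EuclideanSpace ℝ (Fin n) → ℝ → EuclideanSpace ℝ (Fin n) → ℝ)
    (u : EuclideanSpace ℝ (Fin n) → ℝ) : Prop :=
  ∀ x ∈ Ω, symmMat k (hessian u x) = ψ x (u x) (gradient u x)

/-- `u = +∞` on `∂Ω`: for `x` in `Ω`, `u(x) → +∞` as the distance of `x` from `∂Ω` tends to `0`. -/
def BlowsUpAtBoundary {n : ℕ} (Ω : Set (EuclideanSpace ℝ (Fin n)))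
    (u : EuclideanSpace ℝ (Fin n) → ℝ) : Prop :=
  Tendsto u (comap (fun x => Metric.infDist x (frontier Ω)) (𝓝 0) ⊓ 𝓟 Ω) atTop

theorem posCone_subset_gardingCone {n k : ℕ} (hk : k ≤ n) : posCone n ⊆ gardingCone n k := by
  have hconv : Convex ℝ (posCone n) := by
    intro x hx y hy a b ha hb hab i
    have h1 := hx i
    have h2 := hy i
    simp only [Pi.add_apply, Pi.smul_apply, smul_eq_mul]
    rcases ha.eq_or_lt with rfl | ha
    · have : b = 1 := by linarith
      subst this
      simpa using h2
    · have := mul_pos ha h1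
      have := mul_nonneg hb h2.le
      linarith
  refine hconv.isPreconnected.subset_connectedComponentIn (fun _ => one_pos) fun l hl => ?_
  refine Finset.sum_pos (fun s _ => Finset.prod_pos fun i _ => hl i) ?_
  exact Finset.powersetCard_nonempty.2 (by simpa using hk)

theorem hessian_isHermitian {n : ℕ} {Ω : Set (EuclideanSpace ℝ (Fin n))} (hΩ : IsOpen Ω)
    {u : EuclideanSpace ℝ (Fin n) → ℝ} (hu : ContDiffOn ℝ 2 u Ω)
    {x : EuclideanSpace ℝ (Fin n)} (hx : x ∈ Ω) : (hessian u x).IsHermitian := by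
  have h := (hu.contDiffAt (hΩ.mem_nhds hx)).isSymmSndFDerivAt (by simp)
  ext i j
  simpa [hessian] using h _ _

end HessianEq

end

open scoped RealInnerProductSpace

namespace HessianEq

/-! Compare `u + C` with multiples of the Gaussian `exp (A‖x - p‖² / 2)`. Since `u` blows up at the
boundary, the quotient has an interior minimum `x`. There, with `U = u x + C`, the gradient is `U A
(x - p)` and `D²u ≥ U A (I + A (x - p) ⊗ (x - p))` (`derivatives_at_gaussian_contact`). The rank-one
term gives `S_k` one more power of `A`: it is at least `(U A)^k A ‖x - p‖² / n`
(`le_symmMat_of_forall_le`). As `γ + q ≤ k`, the equation bounds it by a constant times `(U A)^k`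
(`growth_le`). The powers of `U` cancel, so a large `A` is contradictory. -/

/-- A local minimum of a twice differentiable function of one variable has nonnegative second
derivative. -/
theorem nonneg_of_isLocalMin_of_hasDerivAt {g g' : ℝ → ℝ} {a c : ℝ} (hmin : IsLocalMin g a)
    (hg : ∀ᶠ s in 𝓝 a, HasDerivAt g (g' s) s) (hg' : HasDerivAt g' c a) : 0 ≤ c := by
  by_contra! hc
  have hd : deriv g =ᶠ[𝓝 a] g' := hg.mono fun s hs => hs.deriv
  have hdd : deriv (deriv g) a = c := by rw [hd.deriv_eq, hg'.deriv]
  -- If `c < 0`, then `a` is also a local maximum, so `g` is constant near `a` and `c = 0`.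
  have hmax : IsLocalMax g a :=
    isLocalMax_of_deriv_deriv_neg (by rwa [hdd]) hmin.deriv_eq_zero hg.self_of_nhds.continuousAt
  have hconst : g =ᶠ[𝓝 a] fun _ => g a := by
    filter_upwards [hmin, hmax] with s h1 h2 using le_antisymm h2 h1
  have hd0 : deriv g =ᶠ[𝓝 a] fun _ => (0 : ℝ) := by
    simpa using hconst.deriv
  have h0 : deriv (deriv g) a = 0 := by simp [hd0.deriv_eq]
  linarith

/-- A continuous function on a nonempty bounded open set that blows up at the boundary attains its
minimum. -/
theorem BlowsUpAtBoundary.exists_isMinOn {n : ℕ} {Ω : Set (EuclideanSpace ℝ (Fin n))}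
    (hΩ : IsOpen Ω) (hne : Ω.Nonempty) (hbdd : Bornology.IsBounded Ω)
    {f : EuclideanSpace ℝ (Fin n) → ℝ} (hf : ContinuousOn f Ω)
    (hblow : BlowsUpAtBoundary Ω f) : ∃ x ∈ Ω, IsMinOn f Ω x := by
  obtain ⟨y, hy⟩ := hne
  have hev := hblow.eventually (eventually_ge_atTop (f y))
  rw [eventually_inf_principal, eventually_comap] at hev
  obtain ⟨δ, hδ, hball⟩ := Metric.eventually_nhds_iff.1 hev
  have hnear : ∀ x ∈ Ω, Metric.infDist x (frontier Ω) < δ → f y ≤ f x := fun x hx h =>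
    hball (by simpa [abs_of_nonneg Metric.infDist_nonneg] using h) x rfl hx
  -- On `Ω` outside this compact set `f ≥ f y`, so the minimizer is either `y` or a minimizer over
  -- `K`.
  set K : Set (EuclideanSpace ℝ (Fin n)) :=
    closure Ω ∩ {x | δ ≤ Metric.infDist x (frontier Ω)} with hKdef
  have hKΩ : K ⊆ Ω := by
    rintro x ⟨hx, hxδ⟩
    by_contra hxΩ
    have hxf : x ∈ frontier Ω := ⟨hx, by rwa [hΩ.interior_eq]⟩
    have := Metric.infDist_zero_of_mem hxf
    simp only [mem_ofPred_eq] at hxδ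
    linarith
  have hK : IsCompact K := (hbdd.isCompact_closure).inter_right
    (isClosed_le continuous_const (Metric.continuous_infDist_pt _))
  have hout : ∀ x ∈ Ω, x ∉ K → f y ≤ f x := fun x hx hxK => by
    refine hnear x hx ?_
    by_contra! h
    exact hxK ⟨subset_closure hx, h⟩
  rcases K.eq_empty_or_nonempty with hempty | hKne
  · exact ⟨y, hy, fun x hx => hout x hx (by simp [hempty])⟩
  obtain ⟨z, hz, hzmin⟩ := hK.exists_isMinOn hKne (hf.mono hKΩ)
  by_cases hzy : f z ≤ f y
  · refine ⟨z, hKΩ hz, fun x hx => ?_⟩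
    by_cases hxK : x ∈ K
    · exact hzmin hxK
    · exact hzy.trans (hout x hx hxK)
  · refine ⟨y, hy, fun x hx => ?_⟩
    by_cases hxK : x ∈ K
    · exact (not_le.1 hzy).le.trans (hzmin hxK)
    · exact hout x hx hxK

/-- First and second order conditions at a point where `u + C` touches from above a multiple of the
Gaussian `exp (A‖x - p‖² / 2)`. -/
theorem derivatives_at_gaussian_contact {E : Type*} [NormedAddCommGroup E] [InnerProductSpace ℝ E]
    {u : E → ℝ} {x p : E} {A C : ℝ} (hu : ContDiffAt ℝ 2 u x)
    (hmin : IsLocalMin (fun y => (u y + C) * Real.exp (-(A / 2 * ‖y - p‖ ^ 2))) x) (ξ : E) :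
    fderiv ℝ u x ξ = (u x + C) * (A * ⟪x - p, ξ⟫) ∧
      (u x + C) * (A * ‖ξ‖ ^ 2 + (A * ⟪x - p, ξ⟫) ^ 2) ≤ fderiv ℝ (fderiv ℝ u) x ξ ξ := by
  set b := ⟪x - p, ξ⟫ with hb
  set t := (u x + C) * Real.exp (-(A / 2 * ‖x - p‖ ^ 2)) with ht
  set Q : ℝ → ℝ := fun s => A / 2 * (‖x - p‖ ^ 2 + 2 * b * s + ‖ξ‖ ^ 2 * s ^ 2) with hQ
  have hline : ∀ s : ℝ, HasDerivAt (fun s : ℝ => x + s • ξ) ξ s := fun s => by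
    simpa using ((hasDerivAt_id s).smul_const ξ).const_add x
  have hcont : Tendsto (fun s : ℝ => x + s • ξ) (𝓝 0) (𝓝 x) := by
    have := (hline 0).continuousAt.tendsto
    simpa using this
  have hnorm : ∀ s : ℝ, A / 2 * ‖x + s • ξ - p‖ ^ 2 = Q s := fun s => by
    have : x + s • ξ - p = (x - p) + s • ξ := by abel
    rw [this, norm_add_sq_real, inner_smul_right, norm_smul, mul_pow, Real.norm_eq_abs, sq_abs, hQ,
      hb]
    ring
  have hQd : ∀ s, HasDerivAt Q (A * (b + ‖ξ‖ ^ 2 * s)) s := fun s => by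
    have h := ((((hasDerivAt_id s).const_mul (2 * b)).const_add (‖x - p‖ ^ 2)).add
      (((hasDerivAt_id s).pow 2).const_mul (‖ξ‖ ^ 2))).const_mul (A / 2)
    refine h.congr_deriv ?_
    simp
    ring
  have hQ0 : t * Real.exp (Q 0) = u x + C := by
    have h0 : Q 0 = A / 2 * ‖x - p‖ ^ 2 := by simp [hQ]
    rw [ht, mul_assoc, ← Real.exp_add, h0]
    simp
  -- Along the line, `t * exp (Q s)` lies below `u + C` and meets it at `s = 0`.
  have hgmin : IsLocalMin (fun s : ℝ => u (x + s • ξ) - t * Real.exp (Q s)) 0 := by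
    filter_upwards [hcont.eventually hmin] with s hs
    simp only [zero_smul, add_zero]
    rw [hQ0]
    rw [hnorm s, ← ht] at hs
    have := mul_le_mul_of_nonneg_right hs (Real.exp_pos (Q s)).le
    rw [mul_assoc _ (Real.exp (-Q s)), ← Real.exp_add, neg_add_cancel, Real.exp_zero] at this
    linarith
  have hgd : ∀ᶠ s : ℝ in 𝓝 0, HasDerivAt (fun s : ℝ => u (x + s • ξ) - t * Real.exp (Q s))
      (fderiv ℝ u (x + s • ξ) ξ - t * (Real.exp (Q s) * (A * (b + ‖ξ‖ ^ 2 * s)))) s := by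
    have hev : ∀ᶠ y in 𝓝 x, DifferentiableAt ℝ u y :=
      (hu.eventually (by simp)).mono fun y hy => hy.differentiableAt (by simp)
    filter_upwards [hcont.eventually hev] with s hs
    exact (hs.hasFDerivAt.comp_hasDerivAt s (hline s)).sub ((hQd s).exp.const_mul t)
  have hgdd : HasDerivAt
      (fun s : ℝ => fderiv ℝ u (x + s • ξ) ξ - t * (Real.exp (Q s) * (A * (b + ‖ξ‖ ^ 2 * s))))
      (fderiv ℝ (fderiv ℝ u) x ξ ξ - (u x + C) * (A * ‖ξ‖ ^ 2 + (A * b) ^ 2)) 0 := by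
    have hF : DifferentiableAt ℝ (fderiv ℝ u) (x + (0 : ℝ) • ξ) := by
      simpa using (hu.fderiv_right (m := 1) (by norm_num)).differentiableAt (by simp)
    have h1 : HasDerivAt (fun s : ℝ => fderiv ℝ u (x + s • ξ) ξ)
        (fderiv ℝ (fderiv ℝ u) x ξ ξ) 0 := by
      rw [zero_smul, add_zero] at hF
      have hF' := hF.hasFDerivAt.comp_hasDerivAt_of_eq (0 : ℝ) (hline 0) (by simp)
      exact (ContinuousLinearMap.apply ℝ ℝ ξ).hasFDerivAt.comp_hasDerivAt (0 : ℝ) hF'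
    have h2 : HasDerivAt (fun s : ℝ => A * (b + ‖ξ‖ ^ 2 * s)) (A * ‖ξ‖ ^ 2) 0 := by
      simpa using (((hasDerivAt_id (0 : ℝ)).const_mul (‖ξ‖ ^ 2)).const_add b).const_mul A
    refine (h1.sub (((hQd 0).exp.mul h2).const_mul t)).congr_deriv ?_
    rw [← hQ0, mul_zero, add_zero]
    ring
  refine ⟨?_, by linarith [nonneg_of_isLocalMin_of_hasDerivAt hgmin hgd hgdd]⟩
  have h := hgmin.hasDerivAt_eq_zero hgd.self_of_nhds
  simp only [zero_smul, add_zero, mul_zero] at h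
  rw [← mul_assoc, hQ0] at h
  linarith

theorem dotProduct_hessian_mulVec {n : ℕ} (u : EuclideanSpace ℝ (Fin n) → ℝ)
    (x ξ : EuclideanSpace ℝ (Fin n)) :
    ξ.ofLp ⬝ᵥ (hessian u x).mulVec ξ.ofLp = fderiv ℝ (fderiv ℝ u) x ξ ξ := by
  have hξ : ξ = ∑ i, ξ i • EuclideanSpace.single i (1 : ℝ) := by
    simpa using ((EuclideanSpace.basisFun (Fin n) ℝ).sum_repr ξ).symm
  conv_rhs => rw [hξ]
  simp only [map_sum, map_smul, sum_apply, smul_apply,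
    dotProduct, Matrix.mulVec, hessian, Matrix.of_apply, smul_eq_mul, Finset.mul_sum]
  rw [Finset.sum_comm]
  refine Finset.sum_congr rfl fun i _ => Finset.sum_congr rfl fun j _ => ?_
  ring

/-- If all entries of `l` are at least `a ≥ 0` and one is at least `b ≥ 0`, then
`S_k(l) ≥ a ^ (k - 1) b`. -/
theorem pow_mul_le_symm {n k : ℕ} (hkn : k + 1 ≤ n) {l : Fin n → ℝ} {a b : ℝ} (ha : 0 ≤ a)
    (hb : 0 ≤ b) (hl : ∀ i, a ≤ l i) {i : Fin n} (hi : b ≤ l i) :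
    a ^ k * b ≤ symm (k + 1) l := by
  obtain ⟨s, his, -, hs⟩ := Finset.exists_subsuperset_card_eq
    (Finset.subset_univ ({i} : Finset (Fin n))) (n := k + 1) (by simp) (by simpa using hkn)
  have hi' : i ∈ s := his (Finset.mem_singleton_self i)
  have hle : ∏ j ∈ s, l j ≤ symm (k + 1) l :=
    Finset.single_le_sum (f := fun s : Finset (Fin n) => ∏ j ∈ s, l j)
      (fun s _ => Finset.prod_nonneg fun j _ => ha.trans (hl j))
      (Finset.mem_powersetCard.2 ⟨Finset.subset_univ s, hs⟩)
  refine le_trans ?_ hle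
  rw [← Finset.prod_erase_mul s l hi']
  refine mul_le_mul ?_ hi hb (Finset.prod_nonneg fun j _ => ha.trans (hl j))
  have := Finset.prod_le_prod (s := s.erase i) (f := fun _ => a) (g := l) (fun _ _ => ha)
    fun j _ => hl j
  simpa [Finset.card_erase_of_mem hi', hs] using this

/-- If `⟨Bξ, ξ⟩ ≥ a (|ξ|² + c ⟨y, ξ⟩²)`, then `S_{k+1}(B) ≥ a ^ (k + 1) c |y|² / n`. -/
theorem le_symmMat_of_forall_le {n k : ℕ} (hkn : k + 1 ≤ n) {B : Matrix (Fin n) (Fin n) ℝ}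
    (hB : B.IsHermitian) {a c : ℝ} (ha : 0 ≤ a) (hc : 0 ≤ c) (y : EuclideanSpace ℝ (Fin n))
    (h : ∀ ξ : EuclideanSpace ℝ (Fin n),
      a * (‖ξ‖ ^ 2 + c * ⟪y, ξ⟫ ^ 2) ≤ ξ.ofLp ⬝ᵥ B.mulVec ξ.ofLp) :
    a ^ (k + 1) * (c * ‖y‖ ^ 2 / n) ≤ symmMat (k + 1) B := by
  have hn : (0 : ℝ) < n := by exact_mod_cast (by omega : 0 < n)
  have heigs : eigs B = hB.eigenvalues := dif_pos hB
  have hlow : ∀ i, a ≤ eigs B i := fun i => by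
    have h1 := h (hB.eigenvectorBasis i)
    have h2 := hB.eigenvalues_eq i
    simp only [star_trivial, RCLike.re_to_real] at h2
    rw [heigs, h2]
    refine le_trans ?_ h1
    rw [(hB.eigenvectorBasis.orthonormal.1 i)]
    nlinarith [mul_nonneg ha (mul_nonneg hc (sq_nonneg ⟪y, hB.eigenvectorBasis i⟫))]
  have htrace : ∑ i, eigs B i = B.trace := by
    rw [heigs, hB.trace_eq_sum_eigenvalues]
    simp
  -- The trace bounds the average eigenvalue from below, hence the largest one. This costs only a
  -- factor `n`.
  have hbig : a * (c * ‖y‖ ^ 2) ≤ ∑ i, eigs B i := by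
    rw [htrace, Matrix.trace, EuclideanSpace.real_norm_sq_eq, Finset.mul_sum, Finset.mul_sum]
    refine Finset.sum_le_sum fun i _ => ?_
    have h1 := h (EuclideanSpace.single i 1)
    simp [EuclideanSpace.inner_single_right] at h1
    simp only [Matrix.diag_apply]
    linarith
  obtain ⟨i, hi⟩ : ∃ i, a * (c * ‖y‖ ^ 2) / n ≤ eigs B i := by
    by_contra! hlt
    have : ∑ i, eigs B i < ∑ _i : Fin n, a * (c * ‖y‖ ^ 2) / n :=
      Finset.sum_lt_sum_of_nonempty ⟨⟨0, by omega⟩, Finset.mem_univ _⟩ fun i _ => hlt i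
    rw [Finset.sum_const, Finset.card_univ, Fintype.card_fin, nsmul_eq_mul,
      mul_div_cancel₀ _ hn.ne'] at this
    linarith
  have := pow_mul_le_symm hkn ha (by positivity) hlow hi
  refine le_trans (le_of_eq ?_) this
  ring

/-- A bounded set is contained in a spherical shell around some point of the space. -/
theorem exists_shell_of_isBounded {E : Type*} [NormedAddCommGroup E] [NormedSpace ℝ E]
    [Nontrivial E] {Ω : Set E} (hΩ : Bornology.IsBounded Ω) :
    ∃ (p : E) (R : ℝ), 1 ≤ R ∧ ∀ x ∈ Ω, 1 ≤ ‖x - p‖ ∧ ‖x - p‖ ≤ R := by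
  obtain ⟨r, hr, hball⟩ := hΩ.exists_pos_norm_le
  -- The center lies at distance at least `1` from the ball of radius `r` that contains `Ω`.
  obtain ⟨p, hp⟩ := exists_norm_eq E (by positivity : (0 : ℝ) ≤ r + 1)
  refine ⟨p, 2 * r + 1, by linarith, fun x hx => ⟨?_, ?_⟩⟩
  · have h1 := norm_sub_norm_le p x
    rw [norm_sub_rev] at h1
    linarith [hball x hx]
  · linarith [norm_sub_le x p, hball x hx]

/-- The growth condition bounds the right-hand side by the `k`-th power of `U` when `z ≤ U` and
the gradient has length between `1` and `U L`. -/
theorem growth_le {k : ℕ} {M γ q z U L G : ℝ} (hM : 0 ≤ M) (hγ : 0 ≤ γ) (hq : 0 ≤ q)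
    (hγq : γ + q ≤ k) (hU : 1 ≤ U) (hz : z ≤ U) (hL : 1 ≤ L) (hG : 1 ≤ G) (hGU : G ≤ U * L) :
    M * (1 + (max z 0) ^ q) * (1 + G ^ γ) ≤ 4 * M * L ^ k * U ^ k := by
  have hU0 : 0 < U := by linarith
  have hL0 : 0 < L := by linarith
  have h1 : 1 + (max z 0) ^ q ≤ 2 * U ^ q := by
    have h2 : (max z 0) ^ q ≤ U ^ q :=
      Real.rpow_le_rpow (le_max_right _ _) (max_le hz hU0.le) hq
    linarith [Real.one_le_rpow hU hq]
  have h2 : 1 + G ^ γ ≤ 2 * (U ^ γ * L ^ γ) := by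
    have h3 : G ^ γ ≤ (U * L) ^ γ := Real.rpow_le_rpow (by linarith) hGU hγ
    rw [Real.mul_rpow hU0.le hL0.le] at h3
    linarith [Real.one_le_rpow hG hγ]
  have h3 : U ^ q * U ^ γ ≤ U ^ k := by
    rw [← Real.rpow_add hU0, ← Real.rpow_natCast]
    exact Real.rpow_le_rpow_of_exponent_le hU (by linarith)
  have h4 : L ^ γ ≤ L ^ k := by
    rw [← Real.rpow_natCast]
    exact Real.rpow_le_rpow_of_exponent_le hL (by linarith)
  have hG0 : 0 ≤ G := by linarith
  calc M * (1 + (max z 0) ^ q) * (1 + G ^ γ)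
      ≤ M * (2 * U ^ q) * (2 * (U ^ γ * L ^ γ)) := by gcongr
    _ = 4 * M * L ^ γ * (U ^ q * U ^ γ) := by ring
    _ ≤ 4 * M * L ^ k * U ^ k := by gcongr

end HessianEq

theorem theorem1p1 (n k : ℕ) (hk : 1 ≤ k) (hkn : k ≤ n - 1)
    (Ω : Set (EuclideanSpace ℝ (Fin n)))
    (hΩ_open : IsOpen Ω) (hΩ_conn : IsConnected Ω) (hΩ_bdd : Bornology.IsBounded Ω)
    (ψ : EuclideanSpace ℝ (Fin n) → ℝ → EuclideanSpace ℝ (Fin n) → ℝ)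
    (hψ : ∃ M γ q : ℝ, 0 ≤ M ∧ 0 ≤ γ ∧ 0 ≤ q ∧ γ + q ≤ k ∧
      ∀ x ∈ Ω, ∀ (z : ℝ) (p : EuclideanSpace ℝ (Fin n)),
        0 ≤ ψ x z p ∧ ψ x z p ≤ M * (1 + (max z 0) ^ q) * (1 + ‖p‖ ^ γ)) :
    ¬ ∃ u : EuclideanSpace ℝ (Fin n) → ℝ,
      HessianEq.IsKConvexOn k Ω u ∧ HessianEq.SolvesHessianEq k Ω ψ u ∧
        HessianEq.BlowsUpAtBoundary Ω u := by
  open HessianEq in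
  rintro ⟨u, ⟨hu, -⟩, hsol, hblow⟩
  obtain ⟨M, γ, q, hM, hγ, hq, hγq, hψ⟩ := hψ
  have hn : (0 : ℝ) < n := by exact_mod_cast (by omega : 0 < n)
  have : Nonempty (Fin n) := ⟨⟨0, by omega⟩⟩
  obtain ⟨p, R, hR, hshell⟩ := exists_shell_of_isBounded hΩ_bdd
  obtain ⟨m, -, hm⟩ := hblow.exists_isMinOn hΩ_open hΩ_conn.nonempty hΩ_bdd hu.continuousOn
  set C := |u m| + 1 with hC
  have hU : ∀ x ∈ Ω, 1 ≤ u x + C := fun x hx => by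
    have : u m ≤ u x := hm hx
    linarith [neg_abs_le (u m)]
  -- Chosen to violate `A ≤ n * (4 * M * R ^ k)`, to which the two bounds on `S_k` reduce.
  set A : ℝ := n * (4 * M * R ^ k) + 1 with hA
  have hA1 : 1 ≤ A := by
    have : 0 ≤ n * (4 * M * R ^ k) := by positivity
    linarith
  have hA0 : 0 < A := by linarith
  have hblow' : BlowsUpAtBoundary Ω
      (fun y => (u y + C) * Real.exp (-(A / 2 * ‖y - p‖ ^ 2))) := by
    have h1 : Tendsto (fun y => (u y + C) * Real.exp (-(A / 2 * R ^ 2)))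
        (comap (fun x => Metric.infDist x (frontier Ω)) (𝓝 0) ⊓ 𝓟 Ω) atTop :=
      (tendsto_atTop_add_const_right _ C hblow).atTop_mul_const (Real.exp_pos _)
    -- On `Ω` the weight is at least its value at radius `R`, so it does not destroy the blow-up.
    refine tendsto_atTop_mono' _ ?_ h1
    filter_upwards [mem_inf_of_right (mem_principal_self Ω)] with y hy
    have h2 := (hshell y hy).2
    have h3 := hU y hy
    gcongr
  obtain ⟨x, hx, hmin⟩ := hblow'.exists_isMinOn hΩ_open hΩ_conn.nonempty hΩ_bdd
    ((hu.continuousOn.add continuousOn_const).mul (by fun_prop))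
  have hcontact := derivatives_at_gaussian_contact (hu.contDiffAt (hΩ_open.mem_nhds hx))
    (hmin.isLocalMin (hΩ_open.mem_nhds hx))
  obtain ⟨hx1, hxR⟩ := hshell x hx
  have hUx := hU x hx
  set U := u x + C with hUdef
  have hU0 : 0 < U := by linarith
  have hgrad : gradient u x = (U * A) • (x - p) := by
    refine ext_inner_right ℝ fun ξ => ?_
    rw [inner_gradient_left, (hcontact ξ).1, real_inner_smul_left]
    ring
  have hnorm : ‖gradient u x‖ = U * (A * ‖x - p‖) := by
    rw [hgrad, norm_smul, Real.norm_of_nonneg (by positivity), mul_assoc]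
  have hupper : symmMat k (hessian u x) ≤ 4 * M * (A * R) ^ k * U ^ k := by
    rw [hsol x hx]
    refine ((hψ x hx _ _).2).trans (growth_le hM hγ hq hγq hUx ?_ ?_ ?_ ?_)
    · have := abs_nonneg (u m)
      linarith
    · exact one_le_mul_of_one_le_of_one_le hA1 hR
    · rw [hnorm]
      exact one_le_mul_of_one_le_of_one_le hUx (one_le_mul_of_one_le_of_one_le hA1 hx1)
    · rw [hnorm]
      gcongr
  obtain ⟨j, rfl⟩ : ∃ j, k = j + 1 := ⟨k - 1, by omega⟩
  have hlower := le_symmMat_of_forall_le (k := j) (by omega) (hessian_isHermitian hΩ_open hu hx)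
    (by positivity : 0 ≤ U * A) hA0.le (x - p) fun ξ => by
      rw [dotProduct_hessian_mulVec]
      refine le_trans (le_of_eq ?_) (hcontact ξ).2
      ring
  -- Because `p` is at distance at least `1` from `x`, the rank-one term cannot degenerate.
  have hle : A / n ≤ A * ‖x - p‖ ^ 2 / n := by
    have : 1 ≤ ‖x - p‖ ^ 2 := one_le_pow₀ hx1
    gcongr
    nlinarith
  have hkey : (U * A) ^ (j + 1) * (A / n) ≤ (U * A) ^ (j + 1) * (4 * M * R ^ (j + 1)) := by
    refine (mul_le_mul_of_nonneg_left hle (by positivity)).trans (hlower.trans (hupper.trans ?_))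
    rw [mul_pow, mul_pow]
    exact le_of_eq (by ring)
  have hfin := le_of_mul_le_mul_left hkey (by positivity)
  rw [div_le_iff₀ hn] at hfin
  linarith
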